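/- An elementary gate is either an arbitrary $1$-qubit unitary applied to one qubit or a CNOT gate on two distinct qubits; the size of a quantum circuit is its number of elementary gates. Theorem. There is an absolute constant $K$ such that the following holds for all integers $n \ge 2$ and $s$. Let $S \subseteq \{0,1\}^n$ be a set of $s$ binary strings and let $(c_x)_{x \in S}$ be complex numbers with $\sum_{x\in S} |c_x|^2 = 1$, so that $|\phi\rangle = \sum_{x \in S} c_x |x\rangle$ is an $n$-qubit $s$-sparse state. Then there is a circuit $C$ of elementary gates on $n+2$ qubits (the $n$ qubits of the state and two ancillary qubits) such that $$C\,\bigl(|0^n\rangle |0^2\rangle\bigr) = |\phi\rangle |0^2\rangle ,$$ and the size of $C$ is at most $K\left(\dfrac{ns}{\log_2 n} + n\right)$. In other words, every $n$-qubit $s$-sparse state can be prepared by a circuit of size $O\!\left(\frac{ns}{\log n} + n\right)$ with two ancillary qubits. -/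

import Mathlib

namespace QCircuit

/-- Bit strings indexed by a set `ι` of qubits: the labels of the computational basis states. -/
abbrev Bits (ι : Type) : Type := ι → Fin 2

/-- State vectors on the qubits `ι`: the value at `x` is the amplitude of the basis state `x`. -/
abbrev StateVec (ι : Type) : Type := Bits ι → ℂ

/-- The computational basis state labelled by `x`. -/
noncomputable def ket {ι : Type} [Fintype ι] [DecidableEq ι] (x : Bits ι) : StateVec ι :=
  Pi.single x 1

/-- The product state of a state on `ι` and a state on `κ`, on the union of the two registers. -/
def tensor {ι κ : Type} (φ : StateVec ι) (χ : StateVec κ) : StateVec (ι ⊕ κ) :=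
  fun z => φ (z ∘ Sum.inl) * χ (z ∘ Sum.inr)

/-- Elementary gates on the qubits `ι`: an arbitrary 2 × 2 unitary applied to one qubit, and the
CNOT gate with two distinct qubits as control and target. -/
inductive Gate (ι : Type) : Type
  | single (U : Matrix.unitaryGroup (Fin 2) ℂ) (i : ι) : Gate ι
  | cnot (control target : ι) (h : control ≠ target) : Gate ι

/-- The linear action of an elementary gate on state vectors. The CNOT gate permutes the basis
states by the involution that adds the control bit to the target bit modulo 2. -/
def Gate.apply {ι : Type} [DecidableEq ι] : Gate ι → StateVec ι → StateVec ι
  | .single U i, ψ => fun x => ∑ b : Fin 2, U.1 (x i) b * ψ (Function.update x i b)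
  | .cnot c t _, ψ => fun x => ψ (Function.update x t (x t + x c))

/-- A circuit over the elementary gates, the first gate of the list being applied first.
Its size is the length of the list. -/
abbrev Circuit (ι : Type) : Type := List (Gate ι)

/-- The action of a circuit on state vectors. -/
def Circuit.run {ι : Type} [DecidableEq ι] (C : Circuit ι) (ψ : StateVec ι) : StateVec ι :=
  C.foldl (fun χ g => g.apply χ) ψ

/-- The number of elementary gates of a circuit. -/
def Circuit.size {ι : Type} (C : Circuit ι) : ℕ := List.length C

/-- The circuit `C` on `n` qubits and `m` ancillary qubits maps `|0ⁿ⟩|0ᵐ⟩` to `φ ⊗ |0ᵐ⟩`. -/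
def Circuit.Prepares {n m : ℕ} (C : Circuit (Fin n ⊕ Fin m)) (φ : StateVec (Fin n)) : Prop :=
  C.run (tensor (ket 0) (ket 0)) = tensor φ (ket 0)

/-- The state `∑ x ∈ S, c x |x⟩`. -/
noncomputable def sparseState {n : ℕ} (S : Finset (Bits (Fin n))) (c : Bits (Fin n) → ℂ) :
    StateVec (Fin n) :=
  ∑ x ∈ S, c x • ket x

end QCircuit

/-! Every gate has an inverse gate, so it suffices to carry $|\phi\rangle|00\rangle$ to $|0\rangle$
(`Reach.symm`). This is done by shrinking the support. Two basis states merge into one after CNOTs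
that make them differ in a single qubit, followed by a reflection on that qubit which kills one
amplitude. With controls on all other qubits this costs $O(n)$ per merge, hence $O(ns)$ in all.

The logarithm is saved by merging in batches (`exists_batch`). On $m+1$ chosen strings, each qubit
has a column of $m+1$ bits, and there are at most $2^{m+1}$ distinct columns. Adding a
representative of each column to its duplicates clears the duplicates on the chosen strings, and one
ancilla marks the strings that vanish there. A merge then needs controls only on the representatives
and the mark, so $O(2^m)$ gates (`exists_merge`). A batch costs $O(n + m2^m)$, which is $O(n)$ for
$m$ about $\frac12\log_2 n$, and about $s/m$ batches suffice.

The other ingredient is a multiply controlled NOT with linearly many gates (`Permutes.and`); the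
second ancilla serves as its borrowed bit. -/

namespace QCircuit

/-! ### Circuit calculus, inverses, norms, and the CCZ gate -/

section

variable {ι : Type} [DecidableEq ι]

theorem Circuit.run_append (C D : Circuit ι) (ψ : StateVec ι) :
    Circuit.run (C ++ D) ψ = Circuit.run D (Circuit.run C ψ) := by
  simp [Circuit.run, List.foldl_append]

/-- Some circuit of size at most `N` acts on all states as `F`. -/
def Computes (N : ℕ) (F : StateVec ι → StateVec ι) : Prop :=
  ∃ C : Circuit ι, C.length ≤ N ∧ ∀ ψ, C.run ψ = F ψ

/-- Some circuit of size at most `N` acts on all states by precomposition with `f`. -/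
def Permutes (N : ℕ) (f : Bits ι → Bits ι) : Prop :=
  Computes N fun ψ x => ψ (f x)

/-- Some circuit of size at most `N` takes `ψ` to `φ`. -/
def Reach (N : ℕ) (ψ φ : StateVec ι) : Prop :=
  ∃ C : Circuit ι, C.length ≤ N ∧ C.run ψ = φ

theorem Computes.mono {N M : ℕ} {F : StateVec ι → StateVec ι} (h : Computes N F) (hNM : N ≤ M) :
    Computes M F := by
  obtain ⟨C, h₁, h₂⟩ := h
  exact ⟨C, h₁.trans hNM, h₂⟩

theorem Computes.congr {N : ℕ} {F G : StateVec ι → StateVec ι} (h : Computes N F)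
    (hFG : ∀ ψ x, F ψ x = G ψ x) : Computes N G := by
  have : F = G := funext fun ψ => funext fun x => hFG ψ x
  exact this ▸ h

theorem Computes.comp {N M : ℕ} {F G : StateVec ι → StateVec ι} (hF : Computes N F)
    (hG : Computes M G) : Computes (N + M) fun ψ => G (F ψ) := by
  obtain ⟨C, hC, hF⟩ := hF
  obtain ⟨D, hD, hG⟩ := hG
  exact ⟨C ++ D, by rw [List.length_append]; omega,
    fun ψ => by rw [Circuit.run_append, hF, hG]⟩

theorem Computes.gate (g : Gate ι) : Computes 1 g.apply :=
  ⟨[g], le_rfl, fun _ => rfl⟩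

theorem Permutes.mono {N M : ℕ} {f : Bits ι → Bits ι} (h : Permutes N f) (hNM : N ≤ M) :
    Permutes M f :=
  Computes.mono h hNM

/-- Amplitudes are pulled back, so the map of the circuit run first ends up outermost. -/
theorem Permutes.comp {N M : ℕ} {f g : Bits ι → Bits ι} (hf : Permutes N f)
    (hg : Permutes M g) : Permutes (N + M) fun x => f (g x) :=
  Computes.comp hf hg

theorem Permutes.id : Permutes 0 fun x : Bits ι => x :=
  ⟨[], le_rfl, fun _ => rfl⟩

theorem Permutes.cnot {c t : ι} (h : c ≠ t) :
    Permutes 1 fun x : Bits ι => Function.update x t (x t + x c) :=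
  Computes.gate (.cnot c t h)

theorem Computes.reach {N : ℕ} {F : StateVec ι → StateVec ι} (h : Computes N F)
    (ψ : StateVec ι) : Reach N ψ (F ψ) := by
  obtain ⟨C, h₁, h₂⟩ := h
  exact ⟨C, h₁, h₂ ψ⟩

theorem Reach.refl (ψ : StateVec ι) : Reach 0 ψ ψ :=
  ⟨[], le_rfl, rfl⟩

theorem Reach.trans {N M : ℕ} {ψ φ χ : StateVec ι} (h : Reach N ψ φ) (h' : Reach M φ χ) :
    Reach (N + M) ψ χ := by
  obtain ⟨C, hC, rfl⟩ := h
  obtain ⟨D, hD, rfl⟩ := h'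
  exact ⟨C ++ D, by rw [List.length_append]; omega, Circuit.run_append C D ψ⟩

theorem Reach.mono {N M : ℕ} {ψ φ : StateVec ι} (h : Reach N ψ φ) (hNM : N ≤ M) :
    Reach M ψ φ := by
  obtain ⟨C, h₁, h₂⟩ := h
  exact ⟨C, h₁.trans hNM, h₂⟩

theorem fin_two_add_self (a : Fin 2) : a + a = 0 := by
  revert a; decide

theorem fin_two_add_cancel (a b : Fin 2) : a + b + b = a := by
  revert a b; decide

theorem Gate.exists_inverse (g : Gate ι) :
    ∃ g' : Gate ι, ∀ ψ : StateVec ι, g'.apply (g.apply ψ) = ψ := by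
  cases g with
  | single U i =>
    refine ⟨.single U⁻¹ i, fun ψ => ?_⟩
    have hU : (U⁻¹).1 * U.1 = 1 := by
      simp
    have h00 := congrFun (congrFun hU 0) 0
    have h01 := congrFun (congrFun hU 0) 1
    have h10 := congrFun (congrFun hU 1) 0
    have h11 := congrFun (congrFun hU 1) 1
    simp only [Matrix.mul_apply, Fin.sum_univ_two, Matrix.one_apply] at h00 h01 h10 h11
    simp only [one_ne_zero, zero_ne_one, if_true, if_false] at h00 h01 h10 h11
    funext x
    simp only [Gate.apply, Fin.sum_univ_two, Function.update_self, Function.update_idem]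
    have hx : ψ x = ψ (Function.update x i (x i)) := by rw [Function.update_eq_self]
    rw [hx]
    generalize x i = b
    fin_cases b
    · simp only [Fin.zero_eta]
      linear_combination ψ (Function.update x i 0) * h00 + ψ (Function.update x i 1) * h01
    · simp only [Fin.mk_one]
      linear_combination ψ (Function.update x i 0) * h10 + ψ (Function.update x i 1) * h11
  | cnot c t h =>
    refine ⟨.cnot c t h, fun ψ => ?_⟩
    funext x
    simp [Gate.apply, Function.update_of_ne h, fin_two_add_cancel]

theorem Reach.symm {N : ℕ} {ψ φ : StateVec ι} (h : Reach N ψ φ) : Reach N φ ψ := by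
  obtain ⟨C, hC, rfl⟩ := h
  suffices H : ∀ (C : Circuit ι) (ψ : StateVec ι),
      ∃ D : Circuit ι, D.length = C.length ∧ Circuit.run D (Circuit.run C ψ) = ψ by
    obtain ⟨D, h₁, h₂⟩ := H C ψ
    exact ⟨D, h₁.trans_le hC, h₂⟩
  intro C
  induction C with
  | nil => exact fun ψ => ⟨[], rfl, rfl⟩
  | cons g C ih =>
    intro ψ
    obtain ⟨D, h₁, h₂⟩ := ih (g.apply ψ)
    obtain ⟨g', hg'⟩ := g.exists_inverse
    refine ⟨D ++ [g'], by simp [h₁], ?_⟩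
    rw [Circuit.run_append]
    change g'.apply (Circuit.run D (Circuit.run C (g.apply ψ))) = ψ
    rw [h₂, hg']

/-- Flipping bit `i` pairs up the strings, and each pair is counted twice on the left. -/
theorem sum_update_zero_add_update_one [Fintype ι] (F : Bits ι → ℝ) (i : ι) :
    ∑ x, (F (Function.update x i 0) + F (Function.update x i 1)) = 2 * ∑ x, F x := by
  have hinv : Function.Involutive fun x : Bits ι => Function.update x i (x i + 1) := by
    intro x
    simp [fin_two_add_cancel]
  have h1 : ∑ x, F (Function.update x i (x i + 1)) = ∑ x, F x :=
    Equiv.sum_comp hinv.toPerm F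
  have h2 : ∀ x : Bits ι, F (Function.update x i 0) + F (Function.update x i 1) =
      F x + F (Function.update x i (x i + 1)) := by
    intro x
    conv_rhs => enter [1]; rw [← Function.update_eq_self i x]
    generalize x i = b
    fin_cases b
    · simp
    · simp [add_comm]
  rw [Finset.sum_congr rfl fun x _ => h2 x, Finset.sum_add_distrib, h1]
  ring

theorem norm_sq_add_norm_sq_of_unitary (U : Matrix.unitaryGroup (Fin 2) ℂ) (a b : ℂ) :
    ‖U.1 0 0 * a + U.1 0 1 * b‖ ^ 2 + ‖U.1 1 0 * a + U.1 1 1 * b‖ ^ 2 = ‖a‖ ^ 2 + ‖b‖ ^ 2 := by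
  have hU : star U.1 * U.1 = 1 := Matrix.UnitaryGroup.star_mul_self U
  have h00 := congrFun (congrFun hU 0) 0
  have h01 := congrFun (congrFun hU 0) 1
  have h10 := congrFun (congrFun hU 1) 0
  have h11 := congrFun (congrFun hU 1) 1
  simp only [Matrix.mul_apply, Fin.sum_univ_two, Matrix.one_apply, Matrix.star_apply,
    one_ne_zero, zero_ne_one, if_true, if_false, RCLike.star_def] at h00 h01 h10 h11
  apply Complex.ofReal_injective
  push_cast
  simp only [← Complex.conj_mul', map_add, map_mul]
  linear_combination (starRingEnd ℂ a * a) * h00 + (starRingEnd ℂ a * b) * h01 +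
    (starRingEnd ℂ b * a) * h10 + (starRingEnd ℂ b * b) * h11

theorem Gate.sum_norm_sq_apply [Fintype ι] (g : Gate ι) (ψ : StateVec ι) :
    ∑ x, ‖g.apply ψ x‖ ^ 2 = ∑ x, ‖ψ x‖ ^ 2 := by
  cases g with
  | single U i =>
    have h1 := sum_update_zero_add_update_one (fun x => ‖(Gate.single U i).apply ψ x‖ ^ 2) i
    have h2 := sum_update_zero_add_update_one (fun x => ‖ψ x‖ ^ 2) i
    have h3 : ∀ x, ‖(Gate.single U i).apply ψ (Function.update x i 0)‖ ^ 2 +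
        ‖(Gate.single U i).apply ψ (Function.update x i 1)‖ ^ 2 =
        ‖ψ (Function.update x i 0)‖ ^ 2 + ‖ψ (Function.update x i 1)‖ ^ 2 := by
      intro x
      simp only [Gate.apply, Fin.sum_univ_two, Function.update_self, Function.update_idem]
      exact norm_sq_add_norm_sq_of_unitary U _ _
    rw [Finset.sum_congr rfl fun x _ => h3 x] at h1
    linarith
  | cnot c t h =>
    have hinv : Function.Involutive fun x : Bits ι => Function.update x t (x t + x c) := by
      intro x
      simp [Function.update_of_ne h, fin_two_add_cancel]
    exact Equiv.sum_comp hinv.toPerm fun x => ‖ψ x‖ ^ 2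

theorem Reach.sum_norm_sq_eq [Fintype ι] {N : ℕ} {ψ φ : StateVec ι} (h : Reach N ψ φ) :
    ∑ x, ‖φ x‖ ^ 2 = ∑ x, ‖ψ x‖ ^ 2 := by
  obtain ⟨C, -, rfl⟩ := h
  induction C generalizing ψ with
  | nil => rfl
  | cons g C ih => exact (ih (ψ := g.apply ψ)).trans (g.sum_norm_sq_apply ψ)

theorem diagonal_mem_unitaryGroup {w : ℂ} (hw : starRingEnd ℂ w * w = 1) :
    !![1, 0; 0, w] ∈ Matrix.unitaryGroup (Fin 2) ℂ := by
  rw [Matrix.mem_unitaryGroup_iff']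
  ext i j
  fin_cases i <;> fin_cases j <;> simp [Matrix.mul_apply, hw]

/-- The phase that `diag(1, w)` gives to the bit `b`. -/
def bitPhase (w : ℂ) (b : Fin 2) : ℂ := if b = 0 then 1 else w

theorem Computes.phase {w : ℂ} (hw : starRingEnd ℂ w * w = 1) (i : ι) :
    Computes 1 fun (ψ : StateVec ι) x => bitPhase w (x i) * ψ x := by
  refine (Computes.gate (.single ⟨_, diagonal_mem_unitaryGroup hw⟩ i)).congr fun ψ x => ?_
  have hx : ψ x = ψ (Function.update x i (x i)) := by rw [Function.update_eq_self]
  rw [hx]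
  simp only [Gate.apply, Fin.sum_univ_two, bitPhase]
  generalize x i = b
  fin_cases b <;> simp

theorem Permutes.congr {N : ℕ} {f g : Bits ι → Bits ι} (h : Permutes N f)
    (hfg : ∀ x, f x = g x) : Permutes N g := by
  have : f = g := funext hfg
  exact this ▸ h

theorem Computes.phase_add {w : ℂ} (hw : starRingEnd ℂ w * w = 1) {i j : ι} (hij : i ≠ j) :
    Computes 3 fun (ψ : StateVec ι) x => bitPhase w (x j + x i) * ψ x := by
  refine ((Computes.comp (Permutes.cnot hij) (Computes.phase hw j)).comp (Permutes.cnot hij)).congr ?_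
  intro ψ x
  simp [Function.update_of_ne hij, fin_two_add_cancel]

theorem Computes.phase_add_add {w : ℂ} (hw : starRingEnd ℂ w * w = 1) {i j k : ι}
    (hik : i ≠ k) (hjk : j ≠ k) :
    Computes 5 fun (ψ : StateVec ι) x => bitPhase w (x k + x i + x j) * ψ x := by
  refine ((Computes.comp (Permutes.cnot hik) (Computes.phase_add hw hjk)).comp
    (Permutes.cnot hik)).congr ?_
  intro ψ x
  simp [Function.update_of_ne hik, Function.update_of_ne hjk, fin_two_add_cancel]

theorem exists_eighth_root : ∃ w : ℂ, starRingEnd ℂ w * w = 1 ∧ w ^ 4 = -1 := by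
  refine ⟨Complex.exp (↑(Real.pi / 4) * Complex.I), ?_, ?_⟩
  · rw [Complex.conj_mul', Complex.norm_exp_ofReal_mul_I]; simp
  · rw [← Complex.exp_nat_mul]
    have : ((4 : ℕ) : ℂ) * (↑(Real.pi / 4) * Complex.I) = Real.pi * Complex.I := by
      push_cast; ring
    rw [this, Complex.exp_pi_mul_I]

/-- For bits read as integers, $a+b+c-(a\oplus b)-(a\oplus c)-(b\oplus c)+(a\oplus b\oplus c)=4abc$.
Phases $w^{\pm1}$ on these parities therefore multiply to $w^{4abc}=(-1)^{abc}$, at a cost of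
$3\cdot1+3\cdot3+5=17$ gates. -/
theorem Computes.ccz {i j k : ι} (hij : i ≠ j) (hik : i ≠ k) (hjk : j ≠ k) :
    Computes 17 fun (ψ : StateVec ι) x => bitPhase (-1) (x i * x j * x k) * ψ x := by
  obtain ⟨w, hw, hw4⟩ := exists_eighth_root
  have hw' : starRingEnd ℂ (starRingEnd ℂ w) * starRingEnd ℂ w = 1 := by
    rw [Complex.conj_conj, mul_comm]; exact hw
  refine (((((((Computes.phase hw i).comp (Computes.phase hw j)).comp (Computes.phase hw k)).comp
    (Computes.phase_add hw' hij)).comp (Computes.phase_add hw' hik)).comp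
    (Computes.phase_add hw' hjk)).comp (Computes.phase_add_add hw hik hjk)).congr ?_
  intro ψ x
  beta_reduce
  generalize ψ x = y
  generalize starRingEnd ℂ w = v at *
  generalize x i = a
  generalize x j = b
  generalize x k = c
  fin_cases a <;> fin_cases b <;> fin_cases c <;> simp [bitPhase]
  iterate 6 · linear_combination y * (w * v + 1) * hw
  linear_combination y * hw4

theorem mem_unitaryGroup_of_real {c s : ℝ} (hcs : c ^ 2 + s ^ 2 = 1) {e : ℂ}
    (he : starRingEnd ℂ e * e = 1) :
    !![(c : ℂ), -(s : ℂ); e * s, e * c] ∈ Matrix.unitaryGroup (Fin 2) ℂ := by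
  have hcs' : (c : ℂ) ^ 2 + (s : ℂ) ^ 2 = 1 := by exact_mod_cast hcs
  rw [Matrix.mem_unitaryGroup_iff']
  ext i j
  fin_cases i <;> fin_cases j <;> simp [Matrix.mul_apply]
  · linear_combination hcs' + s ^ 2 * he
  · linear_combination (s * c) * he
  · linear_combination (s * c) * he
  · linear_combination hcs' + c ^ 2 * he

end

/-! ### Multiply controlled NOT gates and reflections -/

section

theorem fin_two_eq_ite (b : Fin 2) : b = if b = 1 then 1 else 0 := by
  revert b; decide

theorem ite_mul_ite_fin_two (p q : Prop) [Decidable p] [Decidable q] :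
    (if p then (1 : Fin 2) else 0) * (if q then 1 else 0) = if p ∧ q then 1 else 0 := by
  by_cases hp : p <;> by_cases hq : q <;> simp [hp, hq]

variable {ι : Type}

/-- The conjunction of the bits `c 0, …, c l` of `x`. -/
def prefixAnd (c : ℕ → ι) (x : Bits ι) : ℕ → Fin 2
  | 0 => x (c 0)
  | l + 1 => prefixAnd c x l * x (c (l + 1))

theorem prefixAnd_congr {c : ℕ → ι} {x y : Bits ι} {l : ℕ} (h : ∀ i ≤ l, x (c i) = y (c i)) :
    prefixAnd c x l = prefixAnd c y l := by
  induction l with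
  | zero => exact h 0 le_rfl
  | succ l ih => rw [prefixAnd, prefixAnd, ih fun i hi => h i (by omega), h _ le_rfl]

theorem prefixAnd_eq_ite (c : ℕ → ι) (x : Bits ι) (l : ℕ) :
    prefixAnd c x l = if ∀ i ≤ l, x (c i) = 1 then 1 else 0 := by
  induction l with
  | zero =>
    simp only [prefixAnd, nonpos_iff_eq_zero, forall_eq]
    exact fin_two_eq_ite _
  | succ l ih =>
    have h : (∀ i ≤ l + 1, x (c i) = 1) ↔ (∀ i ≤ l, x (c i) = 1) ∧ x (c (l + 1)) = 1 := by
      refine ⟨fun h => ⟨fun i hi => h i (by omega), h _ le_rfl⟩, fun h i hi => ?_⟩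
      obtain hi | rfl := Nat.le_succ_iff.1 hi
      · exact h.1 i hi
      · exact h.2
    rw [prefixAnd, ih, fin_two_eq_ite (x (c (l + 1))), ite_mul_ite_fin_two]
    simp only [h]

variable [DecidableEq ι]

theorem Computes.single {a b c d : ℂ} (h : !![a, b; c, d] ∈ Matrix.unitaryGroup (Fin 2) ℂ)
    (i : ι) : Computes 1 fun (ψ : StateVec ι) x =>
      (if x i = 0 then a else c) * ψ (Function.update x i 0) +
      (if x i = 0 then b else d) * ψ (Function.update x i 1) := by
  refine (Computes.gate (.single ⟨_, h⟩ i)).congr fun ψ x => ?_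
  simp only [Gate.apply, Fin.sum_univ_two]
  generalize x i = b
  fin_cases b <;> simp

theorem Permutes.not (i : ι) :
    Permutes 1 fun x : Bits ι => Function.update x i (x i + 1) := by
  have h : !![(0 : ℂ), 1; 1, 0] ∈ Matrix.unitaryGroup (Fin 2) ℂ := by
    rw [Matrix.mem_unitaryGroup_iff']
    ext i j
    fin_cases i <;> fin_cases j <;> simp [Matrix.mul_apply]
  refine (Computes.single h i).congr fun ψ x => ?_
  beta_reduce
  generalize x i = b
  fin_cases b <;> simp

theorem Permutes.toffoli {i j t : ι} (hij : i ≠ j) (hit : i ≠ t) (hjt : j ≠ t) :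
    Permutes 19 fun x : Bits ι => Function.update x t (x t + x i * x j) := by
  obtain ⟨r, hr⟩ : ∃ r : ℝ, r ^ 2 + r ^ 2 = 1 :=
    ⟨√(1 / 2), by rw [Real.sq_sqrt (by norm_num)]; norm_num⟩
  have hr' : (r : ℂ) ^ 2 + (r : ℂ) ^ 2 = 1 := by exact_mod_cast hr
  -- These parameters give the Hadamard gate, which conjugates CCZ into the Toffoli gate.
  have h := mem_unitaryGroup_of_real (c := r) (s := -r) (e := -1) (by rw [neg_sq]; exact hr)
    (by simp)
  refine (((Computes.single h t).comp (Computes.ccz hij hit hjt)).comp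
    (Computes.single h t)).congr fun ψ x => ?_
  have hx : ψ (Function.update x t (x t + x i * x j)) =
      (r ^ 2 + r ^ 2) * ψ (Function.update x t (x t + x i * x j)) := by rw [hr', one_mul]
  beta_reduce
  rw [hx]
  simp only [Function.update_self, Function.update_idem, Function.update_of_ne hit,
    Function.update_of_ne hjt]
  generalize x i = a
  generalize x j = b
  generalize x t = c
  fin_cases a <;> fin_cases b <;> fin_cases c <;> simp [bitPhase] <;> ring

theorem Permutes.nots (A : Finset ι) :
    Permutes A.card fun (x : Bits ι) i => if i ∈ A then x i + 1 else x i := by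
  induction A using Finset.induction_on with
  | empty => exact Permutes.id.congr fun x => by simp
  | insert a A ha ih =>
    rw [Finset.card_insert_of_notMem ha]
    refine (ih.comp (Permutes.not a)).congr fun x => ?_
    funext i
    by_cases hi : i = a
    · subst hi; simp [ha]
    · simp [hi]

theorem Permutes.cnots (A : Finset ι) (c : ι → ι) (hc : ∀ i ∈ A, c i ∉ A) :
    Permutes A.card fun (x : Bits ι) i => if i ∈ A then x i + x (c i) else x i := by
  induction A using Finset.induction_on with
  | empty => exact Permutes.id.congr fun x => by simp
  | insert a A ha ih =>
    rw [Finset.card_insert_of_notMem ha]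
    have hca : c a ≠ a := fun h => hc a (Finset.mem_insert_self a A) (by simp [h])
    refine ((ih fun i hi h => hc i (Finset.mem_insert_of_mem hi)
      (Finset.mem_insert_of_mem h)).comp (Permutes.cnot hca)).congr fun x => ?_
    funext i
    by_cases hi : i = a
    · subst hi; simp [ha]
    · by_cases hiA : i ∈ A
      · have : c i ≠ a := fun h => hc i (Finset.mem_insert_of_mem hiA) (by simp [h])
        simp [hi, hiA, this]
      · simp [hi, hiA]

/-- The ladder of Toffoli gates that adds to every bit `w l` with `l ≤ j` the conjunction of the
bits `c 0, …, c l`. -/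
def ladder (c w : ℕ → ι) : ℕ → Bits ι → Bits ι
  | 0, x => Function.update x (w 0) (x (w 0) + x (c 0))
  | j + 1, x =>
    let T : Bits ι → Bits ι := fun y =>
      Function.update y (w (j + 1)) (y (w (j + 1)) + y (w j) * y (c (j + 1)))
    T (ladder c w j (T x))

theorem ladder_of_ne {c w : ℕ → ι} {j : ℕ} {x : Bits ι} {i : ι} (hi : ∀ l ≤ j, i ≠ w l) :
    ladder c w j x i = x i := by
  induction j generalizing x with
  | zero => simp [ladder, Function.update_of_ne (hi 0 le_rfl)]
  | succ j ih =>
    simp only [ladder]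
    rw [Function.update_of_ne (hi _ le_rfl), ih fun l hl => hi l (by omega),
      Function.update_of_ne (hi _ le_rfl)]

/-- The two outer Toffoli gates see `w j` before and after the inner ladder changes it by the
shorter conjunction. The unknown initial value of `w j` cancels, so the bits `w l` need not start at
zero. -/
theorem ladder_apply {c w : ℕ → ι} {j : ℕ} {x : Bits ι}
    (hw : ∀ l ≤ j, ∀ l' ≤ j, w l = w l' → l = l') (hcw : ∀ i ≤ j, ∀ l ≤ j, c i ≠ w l)
    {l : ℕ} (hl : l ≤ j) : ladder c w j x (w l) = x (w l) + prefixAnd c x l := by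
  induction j generalizing x l with
  | zero =>
    obtain rfl : l = 0 := by omega
    simp [ladder, prefixAnd]
  | succ j ih =>
    have hj : ∀ l ≤ j, w l ≠ w (j + 1) := fun l hl h => by
      have := hw l (by omega) (j + 1) le_rfl h
      omega
    have ih' := fun (y : Bits ι) (l : ℕ) (hl : l ≤ j) => ih (x := y)
      (fun l hl l' hl' => hw l (by omega) l' (by omega))
      (fun i hi l hl => hcw i (by omega) l (by omega)) hl
    simp only [ladder]
    set y := Function.update x (w (j + 1)) (x (w (j + 1)) + x (w j) * x (c (j + 1))) with hy
    have hPy : ∀ l ≤ j, prefixAnd c y l = prefixAnd c x l := fun l hl =>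
      prefixAnd_congr fun i hi => Function.update_of_ne (hcw i (by omega) _ le_rfl) _ _
    obtain hl | rfl := Nat.le_succ_iff.1 hl
    · rw [Function.update_of_ne (hj l hl), ih' y l hl, hPy l hl, hy,
        Function.update_of_ne (hj l hl)]
    · rw [Function.update_self, ih' y j le_rfl, hPy j le_rfl,
        ladder_of_ne fun l hl => (hj l hl).symm,
        ladder_of_ne fun l hl => hcw (j + 1) le_rfl l (by omega), hy, Function.update_self,
        Function.update_of_ne (hj j le_rfl), Function.update_of_ne (hcw _ le_rfl _ le_rfl),
        prefixAnd]
      generalize x (w (j + 1)) = a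
      generalize x (w j) = b
      generalize x (c (j + 1)) = d
      generalize prefixAnd c x j = p
      revert a b d p; decide

theorem Permutes.ladder {c w : ℕ → ι} {j : ℕ}
    (hw : ∀ l ≤ j, ∀ l' ≤ j, w l = w l' → l = l') (hcw : ∀ i ≤ j, ∀ l ≤ j, c i ≠ w l) :
    Permutes (38 * j + 1) (ladder c w j) := by
  induction j with
  | zero => exact (Permutes.cnot (hcw 0 le_rfl 0 le_rfl)).congr fun x => rfl
  | succ j ih =>
    have hT := Permutes.toffoli (i := w j) (j := c (j + 1)) (t := w (j + 1))
      (hcw _ le_rfl _ (by omega)).symm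
      (fun h => by have := hw j (by omega) (j + 1) le_rfl h; omega) (hcw _ le_rfl _ le_rfl)
    exact (((hT.comp (ih (fun l hl l' hl' => hw l (by omega) l' (by omega))
      (fun i hi l hl => hcw i (by omega) l (by omega)))).comp hT).mono (by omega)).congr
      fun x => rfl

/-- A second ladder, one rung shorter, undoes the first on every `w l` except the last, so these
bits are only borrowed. -/
theorem Permutes.prefixAnd {c w : ℕ → ι} {j : ℕ}
    (hw : ∀ l ≤ j, ∀ l' ≤ j, w l = w l' → l = l') (hcw : ∀ i ≤ j, ∀ l ≤ j, c i ≠ w l) :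
    Permutes (76 * j + 1) fun x =>
      Function.update x (w j) (x (w j) + QCircuit.prefixAnd c x j) := by
  cases j with
  | zero => exact (Permutes.cnot (hcw 0 le_rfl 0 le_rfl)).congr fun x => rfl
  | succ j =>
    have hw' : ∀ l ≤ j, ∀ l' ≤ j, w l = w l' → l = l' :=
      fun l hl l' hl' => hw l (by omega) l' (by omega)
    have hcw' : ∀ i ≤ j, ∀ l ≤ j, c i ≠ w l := fun i hi l hl => hcw i (by omega) l (by omega)
    refine (((Permutes.ladder hw hcw).comp (Permutes.ladder hw' hcw')).mono (by omega)).congr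
      fun x => ?_
    have hP : ∀ l ≤ j + 1, QCircuit.prefixAnd c (QCircuit.ladder c w j x) l =
        QCircuit.prefixAnd c x l := fun l hl =>
      prefixAnd_congr fun i hi => ladder_of_ne fun l' hl' => hcw i (by omega) l' (by omega)
    have hj : ∀ l ≤ j, w (j + 1) ≠ w l := fun l hl h => by
      have := hw _ le_rfl l (by omega) h
      omega
    funext i
    by_cases hi : ∃ l ≤ j + 1, i = w l
    · obtain ⟨l, hl, rfl⟩ := hi
      rw [ladder_apply hw hcw hl, hP l hl]
      obtain hl | rfl := Nat.le_succ_iff.1 hl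
      · rw [ladder_apply hw' hcw' hl, fin_two_add_cancel, Function.update_of_ne (hj l hl).symm]
      · rw [ladder_of_ne hj, Function.update_self]
    · push Not at hi
      rw [ladder_of_ne hi, ladder_of_ne fun l hl => hi l (by omega),
        Function.update_of_ne (hi _ le_rfl)]

/-- One borrowed bit `b` suffices to combine two controlled additions into one. -/
theorem Permutes.and_of_borrowed {N M : ℕ} {b t : ι} (hbt : b ≠ t) {p q : Bits ι → Fin 2}
    (hpb : ∀ x v, p (Function.update x b v) = p x) (hpt : ∀ x v, p (Function.update x t v) = p x)
    (hqb : ∀ x v, q (Function.update x b v) = q x) (hqt : ∀ x v, q (Function.update x t v) = q x)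
    (hp : Permutes N fun x => Function.update x b (x b + p x))
    (hq : Permutes M fun x => Function.update x t (x t + x b * q x)) :
    Permutes (2 * (N + M)) fun x => Function.update x t (x t + p x * q x) := by
  -- The target receives `q` times the borrowed bit once before and once after `p` is added to that
  -- bit; the difference is `p * q`. Adding `p` twice restores `b`.
  refine (((hp.comp hq).comp (hp.comp hq)).mono (by omega)).congr fun x => ?_
  funext i
  by_cases hib : i = b
  · subst hib
    simp [hpt, hpb, hbt, fin_two_add_cancel]
  by_cases hit : i = t
  · subst hit
    simp [hpt, hpb, hqt, hqb, hbt, hbt.symm]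
    generalize x i = a
    generalize x b = d
    generalize p x = u
    generalize q x = v
    revert a d u v; decide
  · simp [hib, hit]

/-- Each half of the controls lends its bits as work space for the conjunction over the other half;
`b` carries the first conjunction into the second. -/
theorem Permutes.and_enumerated {c : ℕ → ι} {m : ℕ} (hm : 0 < m)
    (hc : ∀ i < m, ∀ j < m, c i = c j → i = j) {b t : ι} (hbt : b ≠ t)
    (hb : ∀ i < m, c i ≠ b) (ht : ∀ i < m, c i ≠ t) :
    Permutes (160 * m + 4) fun x : Bits ι =>
      Function.update x t (x t + if ∀ i < m, x (c i) = 1 then 1 else 0) := by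
  -- Rounding up gives `h - 1 ≤ m - h ≤ h`, so each half contains enough bits for the other to
  -- borrow.
  obtain ⟨h, hh⟩ : ∃ h, h = (m + 1) / 2 := ⟨_, rfl⟩
  have h1 := Permutes.prefixAnd (c := c) (w := fun i => if i < h - 1 then c (h + i) else b)
    (j := h - 1)
    (by
      intro l hl l' hl' h
      split_ifs at h with h1 h2 h2
      · have := hc _ (by omega) _ (by omega) h; omega
      · exact absurd h (hb _ (by omega))
      · exact absurd h.symm (hb _ (by omega))
      · omega)
    (by
      intro i hi l hl h
      split_ifs at h with h1
      · have := hc _ (by omega) _ (by omega) h; omega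
      · exact hb _ (by omega) h)
  have h2 := Permutes.prefixAnd (c := fun i => if i = 0 then b else c (h + (i - 1)))
    (w := fun i => if i < m - h then c i else t) (j := m - h)
    (by
      intro l hl l' hl' h
      split_ifs at h with h1 h2 h2
      · exact hc _ (by omega) _ (by omega) h
      · exact absurd h (ht _ (by omega))
      · exact absurd h.symm (ht _ (by omega))
      · omega)
    (by
      intro i hi l hl h
      split_ifs at h with h1 h2 h2
      · exact hb _ (by omega) h.symm
      · exact hbt h
      · have := hc _ (by omega) _ (by omega) h; omega
      · exact ht _ (by omega) h)
  simp only [lt_irrefl, if_false, prefixAnd_eq_ite] at h1 h2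
  set p : Bits ι → Fin 2 := fun x => if ∀ i < h, x (c i) = 1 then 1 else 0 with hp
  set q : Bits ι → Fin 2 := fun x => if ∀ i < m - h, x (c (h + i)) = 1 then 1 else 0 with hq
  have h1' : Permutes (76 * (h - 1) + 1) fun x => Function.update x b (x b + p x) := by
    refine h1.congr fun x => ?_
    have : (∀ i ≤ h - 1, x (c i) = 1) ↔ ∀ i < h, x (c i) = 1 :=
      forall_congr' fun i => by rw [Nat.le_sub_one_iff_lt (by omega)]
    simp only [hp, this]
  have h2' : Permutes (76 * (m - h) + 1) fun x =>
      Function.update x t (x t + x b * q x) := by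
    refine h2.congr fun x => ?_
    have : (∀ i ≤ m - h, x (if i = 0 then b else c (h + (i - 1))) = 1) ↔
        x b = 1 ∧ ∀ i < m - h, x (c (h + i)) = 1 := by
      refine ⟨fun H => ⟨by simpa using H 0 (by omega), fun i hi => ?_⟩, fun H i hi => ?_⟩
      · simpa using H (i + 1) (by omega)
      · split_ifs with h0
        · exact H.1
        · exact H.2 _ (by omega)
    simp only [this, ← ite_mul_ite_fin_two, ← fin_two_eq_ite, hq]
  have hne : ∀ (s : ι), (∀ i < m, c i ≠ s) → ∀ (x : Bits ι) v,
      p (Function.update x s v) = p x ∧ q (Function.update x s v) = q x := by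
    intro s hs x v
    constructor
    · simp only [hp]
      congr 1
      exact propext (forall₂_congr fun i hi => by rw [Function.update_of_ne (hs i (by omega))])
    · simp only [hq]
      congr 1
      exact propext (forall₂_congr fun i hi => by
        rw [Function.update_of_ne (hs (h + i) (by omega))])
  refine ((Permutes.and_of_borrowed hbt (fun x v => (hne b hb x v).1)
    (fun x v => (hne t ht x v).1) (fun x v => (hne b hb x v).2) (fun x v => (hne t ht x v).2)
    h1' h2').mono (by omega)).congr fun x => ?_
  have hand : (∀ i < m, x (c i) = 1) ↔
      (∀ i < h, x (c i) = 1) ∧ ∀ i < m - h, x (c (h + i)) = 1 := by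
    refine ⟨fun H => ⟨fun i hi => H i (by omega), fun i hi => H _ (by omega)⟩,
      fun H i hi => ?_⟩
    by_cases hih : i < h
    · exact H.1 i hih
    · have := H.2 (i - h) (by omega)
      rwa [Nat.add_sub_cancel' (by omega)] at this
  simp only [hand, ← ite_mul_ite_fin_two, hp, hq]

/-- A multiply controlled NOT gate in linearly many elementary gates and one borrowed bit `b`. -/
theorem Permutes.and (A : Finset ι) {b t : ι} (hbt : b ≠ t) (hb : b ∉ A) (ht : t ∉ A) :
    Permutes (160 * A.card + 4) fun x : Bits ι =>
      Function.update x t (x t + if ∀ i ∈ A, x i = 1 then 1 else 0) := by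
  obtain rfl | hA := A.eq_empty_or_nonempty
  · exact ((Permutes.not t).mono (by omega)).congr fun x => by simp
  have key := Permutes.and_enumerated (c := fun i => A.toList.getD i t) (m := A.card)
    hA.card_pos ?_ hbt ?_ ?_
  · refine key.congr fun x => ?_
    have : (∀ i < A.card, x (A.toList.getD i t) = 1) ↔ ∀ i ∈ A, x i = 1 := by
      simp only [← Finset.mem_toList, List.mem_iff_getElem, ← A.length_toList]
      constructor
      · rintro h i ⟨k, hk, rfl⟩
        have := h k hk
        rwa [List.getD_eq_getElem _ _ hk] at this
      · intro h k hk
        rw [List.getD_eq_getElem _ _ hk]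
        exact h _ ⟨k, hk, rfl⟩
    simp only [this]
  · intro i hi j hj h
    rw [← A.length_toList] at hi hj
    simp only [List.getD_eq_getElem _ _ hi, List.getD_eq_getElem _ _ hj] at h
    exact (List.Nodup.getElem_inj_iff A.nodup_toList).1 h
  · intro i hi h
    rw [← A.length_toList] at hi
    simp only [List.getD_eq_getElem _ _ hi] at h
    exact hb (h ▸ Finset.mem_toList.1 (List.getElem_mem hi))
  · intro i hi h
    rw [← A.length_toList] at hi
    simp only [List.getD_eq_getElem _ _ hi] at h
    exact ht (h ▸ Finset.mem_toList.1 (List.getElem_mem hi))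

theorem Permutes.and_pattern (A : Finset ι) (r : Bits ι) {b t : ι} (hbt : b ≠ t) (hb : b ∉ A)
    (ht : t ∉ A) :
    Permutes (162 * A.card + 4) fun x : Bits ι =>
      Function.update x t (x t + if ∀ i ∈ A, x i = r i then 1 else 0) := by
  have hB : (A.filter fun i => r i = 0).card ≤ A.card := Finset.card_filter_le _ _
  refine ((((Permutes.nots (A.filter fun i => r i = 0)).comp (Permutes.and A hbt hb ht)).comp
    (Permutes.nots (A.filter fun i => r i = 0))).mono (by omega)).congr fun x => ?_
  have hB' : ∀ i ∈ A, (if i ∈ A.filter fun i => r i = 0 then x i + 1 else x i) =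
      if r i = 0 then x i + 1 else x i := fun i hi => by simp [hi]
  have : (∀ i ∈ A, (if i ∈ A.filter fun i => r i = 0 then x i + 1 else x i) = 1) ↔
      ∀ i ∈ A, x i = r i := by
    refine forall₂_congr fun i hi => ?_
    rw [hB' i hi]
    generalize x i = u
    generalize r i = v
    revert u v; decide
  funext i
  simp only [this]
  by_cases hi : i = t
  · subst hi; simp [ht]
  · simp only [Function.update_of_ne hi]
    split_ifs
    · exact fin_two_add_cancel _ _
    · rfl

/-- A multiply controlled reflection. -/
theorem Computes.controlled_reflection {N : ℕ} {t : ι} {p : Bits ι → Prop} [DecidablePred p]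
    (hp : ∀ x v, p (Function.update x t v) ↔ p x)
    (h : Permutes N fun x => Function.update x t (x t + if p x then 1 else 0))
    {c s : ℝ} (hcs : c ^ 2 + s ^ 2 = 1) {e : ℂ} (he : starRingEnd ℂ e * e = 1) :
    Computes (N + 2) fun (ψ : StateVec ι) x =>
      if p x then
        if x t = 0 then
          -(2 * c * s) * ψ (Function.update x t 0) +
            starRingEnd ℂ e * (c ^ 2 - s ^ 2) * ψ (Function.update x t 1)
        else
          e * (c ^ 2 - s ^ 2) * ψ (Function.update x t 0) + 2 * c * s * ψ (Function.update x t 1)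
      else ψ x := by
  have hV := mem_unitaryGroup_of_real hcs he
  have hV' : !![(c : ℂ), starRingEnd ℂ e * s; -(s : ℂ), starRingEnd ℂ e * c] ∈
      Matrix.unitaryGroup (Fin 2) ℂ := by
    have := Unitary.star_mem hV
    convert this using 1
    ext i j
    fin_cases i <;> fin_cases j <;> simp [Matrix.star_apply]
  have hcs' : (c : ℂ) ^ 2 + (s : ℂ) ^ 2 = 1 := by exact_mod_cast hcs
  -- The reflection is the NOT gate conjugated by `V`. Only the NOT needs controls, since `V` and
  -- its adjoint cancel where `p` fails.
  refine ((((Computes.single hV' t).comp h).comp (Computes.single hV t)).mono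
    (by omega)).congr fun ψ x => ?_
  have hx : ψ x = ψ (Function.update x t (x t)) := by rw [Function.update_eq_self]
  simp only [Function.update_self, Function.update_idem, hp]
  rw [hx]
  generalize x t = a
  by_cases hpx : p x
  · fin_cases a <;> simp [hpx]
    · ring
    · linear_combination (2 * c * s * ψ (Function.update x t 1)) * he
  · fin_cases a <;> simp [hpx]
    · linear_combination ψ (Function.update x t 0) * hcs'
    · linear_combination ψ (Function.update x t 1) * (c ^ 2 + s ^ 2) * he +
        ψ (Function.update x t 1) * hcs'

/-- Some reflection takes the second amplitude to zero. -/
theorem exists_reflection_kills (α β : ℂ) : ∃ (c s : ℝ) (e : ℂ), c ^ 2 + s ^ 2 = 1 ∧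
    starRingEnd ℂ e * e = 1 ∧ e * (c ^ 2 - s ^ 2) * α + 2 * c * s * β = 0 := by
  set A := Complex.arg α
  set B := Complex.arg β
  -- The angle `2θ` has cosine and sine proportional to `‖β‖` and `-‖α‖`, and `e` turns the phase of
  -- `α` into that of `β`. If `z = 0`, both amplitudes vanish and any angle works.
  set z : ℂ := ⟨‖β‖, -‖α‖⟩ with hz
  set θ := Complex.arg z / 2 with hθ
  refine ⟨Real.cos θ, Real.sin θ, Complex.exp (↑(B - A) * Complex.I),
    Real.cos_sq_add_sin_sq θ, ?_, ?_⟩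
  · rw [Complex.conj_mul', Complex.norm_exp_ofReal_mul_I]; simp
  have hα : α = ‖α‖ * Complex.exp (A * Complex.I) := (Complex.norm_mul_exp_arg_mul_I α).symm
  have hβ : β = ‖β‖ * Complex.exp (B * Complex.I) := (Complex.norm_mul_exp_arg_mul_I β).symm
  have he : Complex.exp (↑(B - A) * Complex.I) * Complex.exp (A * Complex.I) =
      Complex.exp (B * Complex.I) := by
    rw [← Complex.exp_add]; congr 1; push_cast; ring
  have hcos : ‖z‖ * (Real.cos θ ^ 2 - Real.sin θ ^ 2) = ‖β‖ := by
    have : Real.cos θ ^ 2 - Real.sin θ ^ 2 = Real.cos (Complex.arg z) := by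
      rw [show Complex.arg z = 2 * θ by rw [hθ]; ring, Real.cos_two_mul']
    rw [this, Complex.norm_mul_cos_arg]
  have hsin : ‖z‖ * (2 * Real.cos θ * Real.sin θ) = -‖α‖ := by
    have : 2 * Real.cos θ * Real.sin θ = Real.sin (Complex.arg z) := by
      rw [show Complex.arg z = 2 * θ by rw [hθ]; ring, Real.sin_two_mul]; ring
    rw [this, Complex.norm_mul_sin_arg]
  have hreal : (Real.cos θ ^ 2 - Real.sin θ ^ 2) * ‖α‖ + 2 * Real.cos θ * Real.sin θ * ‖β‖ = 0 := by
    linear_combination (Real.cos θ ^ 2 - Real.sin θ ^ 2) * hsin -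
      (2 * Real.cos θ * Real.sin θ) * hcos
  have hreal' : ((Real.cos θ : ℂ) ^ 2 - (Real.sin θ : ℂ) ^ 2) * (‖α‖ : ℂ) +
      2 * (Real.cos θ : ℂ) * (Real.sin θ : ℂ) * (‖β‖ : ℂ) = 0 := by exact_mod_cast hreal
  linear_combination (Complex.exp (↑(B - A) * Complex.I) *
      ((Real.cos θ : ℂ) ^ 2 - (Real.sin θ : ℂ) ^ 2)) * hα +
    (2 * (Real.cos θ : ℂ) * (Real.sin θ : ℂ)) * hβ +
    (((Real.cos θ : ℂ) ^ 2 - (Real.sin θ : ℂ) ^ 2) * ‖α‖) * he +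
    Complex.exp (B * Complex.I) * hreal'

end

/-! ### Supports and merging of basis states -/

section

variable {ι : Type}

/-- The state `ψ` has no amplitude outside `T`. -/
def SupportedOn (ψ : StateVec ι) (T : Finset (Bits ι)) : Prop := ∀ x ∉ T, ψ x = 0

variable [DecidableEq ι]

theorem Permutes.reach_image [Fintype ι] {N : ℕ} {f : Bits ι → Bits ι} (h : Permutes N f)
    (hf : Function.Involutive f) {ψ : StateVec ι} {T : Finset (Bits ι)} (hψ : SupportedOn ψ T) :
    ∃ φ, Reach N ψ φ ∧ SupportedOn φ (T.image f) := by
  refine ⟨_, Computes.reach h ψ, fun x hx => hψ _ fun hfx => hx ?_⟩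
  exact Finset.mem_image.2 ⟨f x, hfx, hf x⟩

theorem involutive_add_of_notMem {A : Finset ι} {c : ι → ι} (hc : ∀ i ∈ A, c i ∉ A) :
    Function.Involutive fun (x : Bits ι) i => if i ∈ A then x i + x (c i) else x i := by
  intro x
  funext i
  by_cases hi : i ∈ A
  · simp [hi, hc i hi, fin_two_add_cancel]
  · simp [hi]

/-- Marked strings (`x a = 1`) vanish outside `R` and `a`, so two of them differ only inside `R`.
The invariant `I` depends only on qubits outside `R`, which the merge never changes; `b` is
borrowed. -/
theorem exists_merge [Fintype ι] {R : Finset ι} {a b : ι} (ha : a ∉ R) (hb : b ∉ R) (hab : a ≠ b)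
    {I : Bits ι → Prop} (hI : ∀ x y, (∀ i ∉ R, x i = y i) → I x → I y)
    (hI' : ∀ x, I x → x a = 1 → ∀ i ∉ R, i ≠ a → x i = 0)
    {ψ : StateVec ι} {T : Finset (Bits ι)} (hψ : SupportedOn ψ T) (hT : ∀ x ∈ T, I x)
    {u v : Bits ι} (hu : u ∈ T) (hv : v ∈ T) (huv : u ≠ v) (hua : u a = 1) (hva : v a = 1) :
    ∃ φ T', Reach (163 * R.card + 6) ψ φ ∧ SupportedOn φ T' ∧ (∀ x ∈ T', I x) ∧
      T'.card + 1 = T.card ∧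
      (T'.filter fun x => x a = 1).card + 1 = (T.filter fun x => x a = 1).card := by
  obtain ⟨j, hj⟩ := Function.ne_iff.1 huv
  have huvR : ∀ i ∉ R, u i = v i := by
    intro i hi
    by_cases hia : i = a
    · rw [hia, hua, hva]
    · rw [hI' u (hT u hu) hua i hi hia, hI' v (hT v hv) hva i hi hia]
  have hjR : j ∈ R := by
    by_contra h
    exact hj (huvR j h)
  -- Adding bit `j` on `A` removes every difference between `u` and `v` except the one at `j`.
  set A := R.filter fun i => i ≠ j ∧ u i ≠ v i with hA
  have hjA : j ∉ A := by simp [hA]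
  have hRA : ∀ i ∉ R, i ∉ A := fun i hi h => hi (Finset.mem_of_mem_filter i h)
  have hf := involutive_add_of_notMem (A := A) (c := fun _ => j) fun _ _ => hjA
  obtain ⟨χ, hχ, hχT⟩ := (Permutes.cnots A (fun _ => j) fun _ _ => hjA).reach_image hf hψ
  set f : Bits ι → Bits ι := fun x i => if i ∈ A then x i + x j else x i with hfdef
  have hfR : ∀ x, ∀ i ∉ R, f x i = x i := fun x i hi => if_neg (hRA i hi)
  have hIf : ∀ x ∈ T.image f, I x := by
    intro y hy
    obtain ⟨x, hx, rfl⟩ := Finset.mem_image.1 hy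
    exact hI x _ (fun i hi => (hfR x i hi).symm) (hT x hx)
  have hfuv : ∀ i, i ≠ j → f v i = f u i := by
    intro i hi
    by_cases hiA : i ∈ A
    · have := (Finset.mem_filter.1 hiA).2.2
      simp only [hfdef, hiA, if_true]
      revert this hj
      generalize u i = p, v i = q, u j = r, v j = s
      revert p q r s; decide
    · simp only [hfdef, hiA, if_false]
      by_cases hiR : i ∈ R
      · by_contra h
        exact hiA (Finset.mem_filter.2 ⟨hiR, hi, Ne.symm h⟩)
      · exact (huvR i hiR).symm
  have hfj : ∀ x, f x j = x j := fun x => if_neg hjA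
  set w : Bits ι := f u with hw
  have hwa : w a = 1 := (hfR u a ha).trans hua
  have hwT : ∀ c, Function.update w j c ∈ T.image f := by
    intro c
    by_cases hc : c = w j
    · rw [hc, Function.update_eq_self]
      exact Finset.mem_image_of_mem f hu
    · have : Function.update w j c = f v := by
        funext i
        by_cases hi : i = j
        · subst hi
          rw [Function.update_self, hfj]
          rw [hw, hfj] at hc
          revert hc hj
          generalize u i = p, v i = q
          revert p q c; decide
        · rw [Function.update_of_ne hi, hfuv i hi]
      rw [this]
      exact Finset.mem_image_of_mem f hv
  -- Control on the mark `a` replaces controls on all other qubits outside `R`.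
  set B := insert a (R.erase j) with hB
  have haR : a ∉ R.erase j := fun h => ha (Finset.mem_of_mem_erase h)
  have hja : j ≠ a := fun h => ha (h ▸ hjR)
  have hjb : b ≠ j := fun h => hb (h ▸ hjR)
  have hBcard : B.card = R.card := by
    rw [hB, Finset.card_insert_of_notMem haR, Finset.card_erase_add_one hjR]
  have hjB : j ∉ B := by simp [hB, hja]
  have hbB : b ∉ B := by simp [hB, hab.symm, hb]
  have hpB : ∀ (x : Bits ι) c, (∀ i ∈ B, Function.update x j c i = w i) ↔ ∀ i ∈ B, x i = w i :=
    fun x c => forall₂_congr fun i hi => by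
      rw [Function.update_of_ne (ne_of_mem_of_not_mem hi hjB)]
  obtain ⟨c, s, e, hcs, he, hk⟩ := exists_reflection_kills (χ (Function.update w j 0))
    (χ (Function.update w j 1))
  have hrefl := (Computes.controlled_reflection hpB
    ((Permutes.and_pattern B w hjb hbB hjB).congr fun x => by congr) hcs he).reach χ
  -- No third string of the support passes the controls, so the reflection acts on the merged pair
  -- alone and creates no new basis states.
  have hagree : ∀ x ∈ T.image f, (∀ i ∈ B, x i = w i) → ∀ i, i ≠ j → x i = w i := by
    intro x hx hxB i hi
    by_cases hiB : i ∈ B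
    · exact hxB i hiB
    · have hia : i ≠ a := fun h => hiB (by simp [hB, h])
      have hiR : i ∉ R := fun h => hiB (by simp [hB, h, hi])
      rw [hI' x (hIf x hx) ((hxB a (Finset.mem_insert_self _ _)).trans hwa) i hiR hia,
        hI' w (hIf w (Finset.mem_image_of_mem f hu)) hwa i hiR hia]
  have hcard : ((T.image f).filter fun x => x a = 1).card =
      (T.filter fun x => x a = 1).card := by
    rw [Finset.filter_image, Finset.card_image_of_injective _ hf.injective]
    simp only [hfR _ a ha]
  refine ⟨_, (T.image f).erase (Function.update w j 1), (hχ.trans hrefl).mono ?_, ?_,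
    fun x hx => hIf x (Finset.mem_of_mem_erase hx), ?_, ?_⟩
  · have : A.card ≤ R.card := Finset.card_filter_le _ _
    rw [hBcard]
    omega
  · intro x hx
    rw [Finset.mem_erase, not_and_or, not_not] at hx
    have hoff : (∀ i ∈ B, x i = w i) → x ≠ Function.update w j 1 →
        ∀ d, χ (Function.update x j d) = 0 := by
      intro hp hxw d
      refine hχT _ fun hd => hx.resolve_left hxw ?_
      have : x = Function.update w j (x j) := by
        funext i
        by_cases hi : i = j
        · subst hi; simp
        · have := hagree _ hd ((hpB x d).2 hp) i hi
          rw [Function.update_of_ne hi] at this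
          rw [Function.update_of_ne hi, this]
      exact this ▸ hwT _
    beta_reduce
    split_ifs with hp hxj
    · have hxw : x ≠ Function.update w j 1 := by
        rintro rfl
        simp at hxj
      rw [hoff hp hxw, hoff hp hxw]
      ring
    · by_cases hxw : x = Function.update w j 1
      · subst hxw
        simpa using hk
      · rw [hoff hp hxw, hoff hp hxw]
        ring
    · refine hχT x (hx.resolve_left ?_)
      rintro rfl
      exact hp ((hpB w 1).2 fun _ _ => rfl)
  · rw [Finset.card_erase_add_one (hwT 1), Finset.card_image_of_injective _ hf.injective]
  · rw [Finset.filter_erase, Finset.card_erase_add_one, hcard]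
    exact Finset.mem_filter.2 ⟨hwT 1, by rw [Function.update_of_ne hja.symm, hwa]⟩

theorem exists_merges [Fintype ι] {R : Finset ι} {a b : ι} (ha : a ∉ R) (hb : b ∉ R)
    (hab : a ≠ b) {I : Bits ι → Prop} (hI : ∀ x y, (∀ i ∉ R, x i = y i) → I x → I y)
    (hI' : ∀ x, I x → x a = 1 → ∀ i ∉ R, i ≠ a → x i = 0) (m : ℕ)
    {ψ : StateVec ι} {T : Finset (Bits ι)} (hψ : SupportedOn ψ T) (hT : ∀ x ∈ T, I x)
    (hm : m < (T.filter fun x => x a = 1).card) :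
    ∃ φ T', Reach (m * (163 * R.card + 6)) ψ φ ∧ SupportedOn φ T' ∧ (∀ x ∈ T', I x) ∧
      T'.card + m = T.card := by
  induction m generalizing ψ T with
  | zero => exact ⟨ψ, T, (Reach.refl ψ).mono (by omega), hψ, hT, rfl⟩
  | succ m ih =>
    obtain ⟨u, hu, v, hv, huv⟩ := Finset.one_lt_card.1 (by omega : 1 < (T.filter fun x => x a = 1).card)
    rw [Finset.mem_filter] at hu hv
    obtain ⟨χ, T₁, h₁, h₂, h₃, h₄, h₅⟩ :=
      exists_merge ha hb hab hI hI' hψ hT hu.1 hv.1 huv hu.2 hv.2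
    obtain ⟨φ, T₂, h₁', h₂', h₃', h₄'⟩ := ih h₂ h₃ (by omega)
    exact ⟨φ, T₂, (h₁.trans h₁').mono (le_of_eq (by ring)), h₂', h₃', by omega⟩

end

/-! ### Batches of merges and the final count -/

section

variable {ι : Type} [DecidableEq ι]

/-- Merging `m` basis states: coordinates on which `m + 1` chosen strings have equal columns are
cleared by CNOT gates, and the ancilla `a` then marks the strings that vanish on them. -/
theorem exists_batch [Fintype ι] {a b : ι} (hab : a ≠ b) {ψ : StateVec ι} {T : Finset (Bits ι)}
    (hψ : SupportedOn ψ T) (hT : ∀ x ∈ T, x a = 0 ∧ x b = 0) {m : ℕ} (hm : m < T.card) :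
    ∃ φ T', Reach (325 * Fintype.card ι + 8 + m * (163 * 2 ^ (m + 1) + 6)) ψ φ ∧
      SupportedOn φ T' ∧ (∀ x ∈ T', x a = 0 ∧ x b = 0) ∧ T'.card + m = T.card := by
  -- Performing `m` merges requires `m + 1` marked strings.
  obtain ⟨B, hBT, hB⟩ := Finset.exists_subset_card_eq (Nat.succ_le_of_lt hm)
  set D : Finset ι := Finset.univ \ {a, b} with hD
  -- `R` contains one qubit for each distinct column of the chosen strings.
  let col : ι → B → Fin 2 := fun i x => x.1 i
  obtain ⟨R, hRD, hRinj, hRim⟩ := Finset.exists_subset_injOn_image_eq_of_surjOn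
    (f := col) (D : Set ι) (D.image col) (by
      rw [Finset.coe_image]; exact Set.surjOn_image _ _)
  have hRD : R ⊆ D := by exact_mod_cast hRD
  have hRcard : R.card ≤ 2 ^ (m + 1) := by
    rw [← Finset.card_image_of_injOn hRinj]
    refine (Finset.card_le_univ _).trans ?_
    simp [hB]
  have hrep : ∀ i, ∃ i', i ∈ D → i' ∈ R ∧ ∀ x ∈ B, x i' = x i := by
    intro i
    by_cases hi : i ∈ D
    · obtain ⟨i', hi', h⟩ := Finset.mem_image.1 (hRim ▸ Finset.mem_image_of_mem col hi)
      exact ⟨i', fun _ => ⟨hi', fun x hx => congrFun h ⟨x, hx⟩⟩⟩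
    · exact ⟨i, fun h => absurd h hi⟩
  choose rep hrep using hrep
  set N := D \ R with hN
  have hND : N ⊆ D := Finset.sdiff_subset
  have haD : a ∉ D := by simp [hD]
  have hbD : b ∉ D := by simp [hD]
  have hcN : N.card ≤ Fintype.card ι := Finset.card_le_univ N
  have hcnot : ∀ i ∈ N, rep i ∉ N := fun i hi h =>
    (Finset.mem_sdiff.1 h).2 (hrep i (hND hi)).1
  have hf := involutive_add_of_notMem hcnot
  obtain ⟨ψ₁, h₁, hψ₁⟩ := (Permutes.cnots N rep hcnot).reach_image hf hψ
  set f : Bits ι → Bits ι := fun x i => if i ∈ N then x i + x (rep i) else x i with hfdef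
  have hfD : ∀ x, ∀ i ∉ D, f x i = x i := fun x i hi => if_neg fun h => hi (hND h)
  set g : Bits ι → Bits ι :=
    fun x => Function.update x a (x a + if ∀ i ∈ N, x i = 0 then 1 else 0) with hgdef
  have hmark : Permutes (162 * N.card + 4) g :=
    (Permutes.and_pattern N 0 hab.symm (fun h => hbD (hND h)) (fun h => haD (hND h))).congr
      fun x => by simp only [hgdef, Pi.zero_apply]; congr
  have hgN : ∀ x c, (∀ i ∈ N, Function.update x a c i = (0 : Fin 2)) ↔ ∀ i ∈ N, x i = 0 :=
    fun x c => forall₂_congr fun i hi => by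
      rw [Function.update_of_ne (ne_of_mem_of_not_mem (hND hi) haD)]
  have hg : Function.Involutive g := by
    intro x
    simp only [hgdef, hgN, Function.update_self, Function.update_idem, fin_two_add_cancel,
      Function.update_eq_self]
  obtain ⟨ψ₂, h₂, hψ₂⟩ := hmark.reach_image hg hψ₁
  -- The mark stays a function of the bits in `N`, which lie outside `R`, so it can be uncomputed
  -- after the merges.
  let I : Bits ι → Prop := fun x => x b = 0 ∧ x a = if ∀ i ∈ N, x i = 0 then 1 else 0
  have hI₂ : ∀ x ∈ (T.image f).image g, I x := by
    intro x hx
    obtain ⟨_, hy, rfl⟩ := Finset.mem_image.1 hx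
    obtain ⟨z, hz, rfl⟩ := Finset.mem_image.1 hy
    refine ⟨?_, ?_⟩
    · simp only [hgdef]
      rw [Function.update_of_ne hab.symm, hfD z b hbD, (hT z hz).2]
    · simp only [hgdef, hgN, Function.update_self]
      rw [hfD z a haD, (hT z hz).1, zero_add]
  have haR : a ∉ R := fun h => haD (hRD h)
  have hbR : b ∉ R := fun h => hbD (hRD h)
  -- Every chosen string now vanishes on `N`. Other strings may be marked too, which does no harm.
  have hmarked : m < (((T.image f).image g).filter fun x => x a = 1).card := by
    have hsub : (B.image f).image g ⊆ ((T.image f).image g).filter fun x => x a = 1 := by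
      intro x hx
      refine Finset.mem_filter.2
        ⟨Finset.image_subset_image (Finset.image_subset_image hBT) hx, ?_⟩
      obtain ⟨_, hy, rfl⟩ := Finset.mem_image.1 hx
      obtain ⟨z, hz, rfl⟩ := Finset.mem_image.1 hy
      have hzN : ∀ i ∈ N, f z i = 0 := by
        intro i hi
        simp only [hfdef, hi, if_true]
        rw [(hrep i (hND hi)).2 z hz, fin_two_add_self]
      simp only [hgdef, Function.update_self, if_pos hzN]
      rw [hfD z a haD, (hT z (hBT hz)).1, zero_add]
    have := Finset.card_le_card hsub
    rw [Finset.card_image_of_injective _ hg.injective,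
      Finset.card_image_of_injective _ hf.injective, hB] at this
    omega
  obtain ⟨ψ₃, T₃, h₃, hψ₃, hI₃, hT₃⟩ := exists_merges haR hbR hab (I := I)
    (by
      rintro x y hxy ⟨hxb, hxa⟩
      refine ⟨(hxy b hbR).symm.trans hxb, (hxy a haR).symm.trans (hxa.trans ?_)⟩
      have : (∀ i ∈ N, x i = 0) ↔ ∀ i ∈ N, y i = 0 := forall₂_congr fun i hi => by
        rw [hxy i (Finset.mem_sdiff.1 hi).2]
      simp only [this])
    (by
      rintro x ⟨hxb, hxa⟩ hxa' i hiR hia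
      have hxN : ∀ i ∈ N, x i = 0 := by
        by_contra h
        rw [if_neg h, hxa'] at hxa
        exact one_ne_zero hxa
      by_cases hib : i = b
      · rw [hib, hxb]
      · exact hxN i (Finset.mem_sdiff.2 ⟨by simp [hD, hia, hib], hiR⟩))
    m hψ₂ hI₂ hmarked
  obtain ⟨ψ₄, h₄, hψ₄⟩ := hmark.reach_image hg hψ₃
  refine ⟨ψ₄, T₃.image g, (((h₁.trans h₂).trans h₃).trans h₄).mono ?_, hψ₄, ?_, ?_⟩
  · have : m * (163 * R.card + 6) ≤ m * (163 * 2 ^ (m + 1) + 6) := by gcongr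
    omega
  · intro x hx
    obtain ⟨z, hz, rfl⟩ := Finset.mem_image.1 hx
    obtain ⟨hzb, hza⟩ := hI₃ z hz
    constructor
    · simp only [hgdef, Function.update_self]
      rw [hza, fin_two_add_self]
    · simp only [hgdef]
      rw [Function.update_of_ne hab.symm, hzb]
  · rw [Finset.card_image_of_injective _ hg.injective, hT₃,
      Finset.card_image_of_injective _ hg.injective,
      Finset.card_image_of_injective _ hf.injective]

theorem exists_batches [Fintype ι] {a b : ι} (hab : a ≠ b) {q : ℕ} (r : ℕ) {ψ : StateVec ι}
    {T : Finset (Bits ι)} (hψ : SupportedOn ψ T) (hT : ∀ x ∈ T, x a = 0 ∧ x b = 0)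
    (hT₀ : T.Nonempty) (hr : T.card ≤ r * q + 1) :
    ∃ φ z, Reach (r * (325 * Fintype.card ι + 8 + q * (163 * 2 ^ (q + 1) + 6))) ψ φ ∧
      SupportedOn φ {z} := by
  induction r generalizing ψ T with
  | zero =>
    obtain ⟨z, rfl⟩ := Finset.card_eq_one.1
      (le_antisymm (by simpa using hr) hT₀.card_pos)
    exact ⟨ψ, z, (Reach.refl ψ).mono (by omega), hψ⟩
  | succ r ih =>
    have hpos := hT₀.card_pos
    have hmq : min q (T.card - 1) ≤ q := min_le_left _ _
    -- The minimum cuts the batch short when fewer than `q` merges remain.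
    obtain ⟨χ, T', h₁, h₂, h₃, h₄⟩ := exists_batch hab hψ hT (m := min q (T.card - 1)) (by omega)
    obtain ⟨φ, z, h₅, h₆⟩ := ih h₂ h₃ (Finset.card_pos.1 (by omega))
      (by rw [Nat.succ_mul r] at hr; omega)
    refine ⟨φ, z, (h₁.trans h₅).mono ?_, h₆⟩
    have : min q (T.card - 1) * (163 * 2 ^ (min q (T.card - 1) + 1) + 6) ≤
        q * (163 * 2 ^ (q + 1) + 6) := by gcongr; norm_num
    rw [Nat.succ_mul r]
    omega

/-- NOT gates bring the last string to zero. Norm conservation makes its amplitude a phase, which is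
removed by a diagonal gate conjugated by NOT, so that it acts on bit value 0. -/
theorem reach_ket_zero [Fintype ι] (i : ι) {φ : StateVec ι} {z : Bits ι}
    (hφ : SupportedOn φ {z}) (hnorm : ∑ x, ‖φ x‖ ^ 2 = 1) :
    Reach (Fintype.card ι + 3) φ (ket 0) := by
  set A : Finset ι := Finset.univ.filter fun i => z i = 1 with hA
  have hinv : Function.Involutive fun (x : Bits ι) i => if i ∈ A then x i + 1 else x i := by
    intro x
    funext i
    by_cases hi : i ∈ A
    · simp [hi, fin_two_add_cancel]
    · simp [hi]
  obtain ⟨χ, h₁, hχ⟩ := (Permutes.nots A).reach_image hinv hφ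
  have hz : (fun i => if i ∈ A then z i + 1 else z i) = 0 := by
    funext i
    simp only [hA, Finset.mem_filter, Finset.mem_univ, true_and, Pi.zero_apply]
    generalize z i = v
    revert v; decide
  rw [Finset.image_singleton, hz] at hχ
  have hχ0 : ∀ x, x ≠ 0 → χ x = 0 := fun x hx => hχ x (by simpa using hx)
  have hχnorm : ‖χ 0‖ ^ 2 = 1 := by
    rw [← hnorm, ← h₁.sum_norm_sq_eq,
      Finset.sum_eq_single 0 (fun x _ hx => by simp [hχ0 x hx]) (by simp)]
  have hw : starRingEnd ℂ (starRingEnd ℂ (χ 0)) * starRingEnd ℂ (χ 0) = 1 := by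
    rw [Complex.conj_conj, Complex.mul_conj']
    exact_mod_cast hχnorm
  have hphase := (((Computes.comp (Permutes.not i) (Computes.phase hw i)).comp
    (Permutes.not i))).reach χ
  have hket : (ket 0 : StateVec ι) = fun x =>
      bitPhase (starRingEnd ℂ (χ 0)) (Function.update x i (x i + 1) i) *
        χ (Function.update (Function.update x i (x i + 1)) i
          (Function.update x i (x i + 1) i + 1)) := by
    funext x
    simp only [Function.update_self, Function.update_idem, fin_two_add_cancel,
      Function.update_eq_self]
    by_cases hx : x = 0
    · subst hx
      rw [Complex.conj_conj] at hw
      simp [ket, bitPhase, mul_comm, hw]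
    · rw [hχ0 x hx, mul_zero, ket, Pi.single_eq_of_ne hx]
  rw [hket]
  refine (h₁.trans hphase).mono ?_
  have := Finset.card_le_univ A
  omega

theorem sparseState_apply {n : ℕ} (S : Finset (Bits (Fin n))) (c : Bits (Fin n) → ℂ)
    (x : Bits (Fin n)) : sparseState S c x = if x ∈ S then c x else 0 := by
  simp [sparseState, ket, Finset.sum_apply, Pi.single_apply]

theorem tensor_ket_zero {n m : ℕ} :
    tensor (ket (0 : Bits (Fin n))) (ket (0 : Bits (Fin m))) = ket 0 := by
  funext z
  have : z = 0 ↔ z ∘ Sum.inl = 0 ∧ z ∘ Sum.inr = 0 := by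
    constructor
    · rintro rfl
      exact ⟨rfl, rfl⟩
    · rintro ⟨h₁, h₂⟩
      funext i
      rcases i with i | i
      · exact congrFun h₁ i
      · exact congrFun h₂ i
  simp only [tensor, ket, Pi.single_apply, this, ite_and]
  split_ifs <;> simp

theorem Reach.prepares {n m N : ℕ} {φ : StateVec (Fin n)}
    (h : Reach N (tensor φ (ket (0 : Bits (Fin m)))) (ket 0)) :
    ∃ C : Circuit (Fin n ⊕ Fin m), C.Prepares φ ∧ C.size ≤ N := by
  obtain ⟨C, hC, hrun⟩ := h.symm
  exact ⟨C, by rw [Circuit.Prepares, tensor_ket_zero, hrun], hC⟩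

theorem exists_reach_sparseState {n : ℕ} (hn : 0 < n) (S : Finset (Bits (Fin n)))
    (c : Bits (Fin n) → ℂ) (hc : ∑ x ∈ S, ‖c x‖ ^ 2 = 1) {q r : ℕ} (hr : S.card ≤ r * q + 1) :
    Reach (r * (325 * (n + 2) + 8 + q * (163 * 2 ^ (q + 1) + 6)) + (n + 2 + 3))
      (tensor (sparseState S c) (ket (0 : Bits (Fin 2)))) (ket 0) := by
  let extend : Bits (Fin n) → Bits (Fin n ⊕ Fin 2) := fun x => Sum.elim x 0
  have hinj : Function.Injective extend := fun x y h =>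
    funext fun i => congrFun h (Sum.inl i)
  have hsupp : SupportedOn (tensor (sparseState S c) (ket (0 : Bits (Fin 2))))
      (S.image extend) := by
    intro z hz
    by_cases h0 : z ∘ Sum.inr = 0
    · have : z ∘ Sum.inl ∉ S := fun h => hz (Finset.mem_image.2 ⟨_, h, by
        change Sum.elim (z ∘ Sum.inl) 0 = z
        rw [← h0, Sum.elim_comp_inl_inr]⟩)
      simp [tensor, sparseState_apply, this]
    · simp [tensor, ket, Pi.single_eq_of_ne h0]
  have hclean : ∀ z ∈ S.image extend, z (Sum.inr 0) = 0 ∧ z (Sum.inr 1) = 0 := by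
    intro z hz
    obtain ⟨x, -, rfl⟩ := Finset.mem_image.1 hz
    exact ⟨rfl, rfl⟩
  have hne : (S.image extend).Nonempty := by
    rw [Finset.image_nonempty, Finset.nonempty_iff_ne_empty]
    rintro rfl
    simp at hc
  have hnorm : ∑ z, ‖tensor (sparseState S c) (ket (0 : Bits (Fin 2))) z‖ ^ 2 = 1 := by
    rw [← Finset.sum_subset (Finset.subset_univ (S.image extend))
      fun z _ hz => by simp [hsupp z hz], Finset.sum_image hinj.injOn, ← hc]
    refine Finset.sum_congr rfl fun x hx => ?_
    have h1 : extend x ∘ Sum.inl = x := rfl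
    have h2 : extend x ∘ Sum.inr = 0 := rfl
    simp [tensor, h1, h2, sparseState_apply, hx, ket]
  have hab : (Sum.inr 0 : Fin n ⊕ Fin 2) ≠ Sum.inr 1 := by simp
  obtain ⟨φ, z, h₁, h₂⟩ := exists_batches hab (q := q) r hsupp hclean hne
    (by rwa [Finset.card_image_of_injective _ hinj])
  have h₃ := reach_ket_zero (Sum.inl ⟨0, hn⟩) h₂ (h₁.sum_norm_sq_eq.trans hnorm)
  have := h₁.trans h₃
  simpa only [Fintype.card_sum, Fintype.card_fin] using this

/-- Batches of `1 + ⌊log₂ n⌋ / 2` merges cost `O(n)` gates. -/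
theorem batch_cost_le {n q : ℕ} (hn : 2 ≤ n) (hq : q = 1 + Nat.log 2 n / 2) :
    325 * (n + 2) + 8 + q * (163 * 2 ^ (q + 1) + 6) ≤ 1312 * n := by
  obtain ⟨j, hj⟩ : ∃ j, j = Nat.log 2 n / 2 := ⟨_, rfl⟩
  have hj1 : 1 + j ≤ 2 ^ j := by
    have := Nat.lt_two_pow_self (n := j)
    omega
  -- One factor `2 ^ j` will bound the number of merges, the other the number of distinct columns.
  have hjn : 2 ^ j * 2 ^ j ≤ n := by
    rw [← pow_add]
    exact (Nat.pow_le_pow_right (by norm_num) (by omega)).trans (Nat.pow_log_le_self 2 (by omega))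
  have hpos : 1 ≤ 2 ^ j := Nat.one_le_two_pow
  rw [hq, ← hj]
  have : (1 + j) * (163 * 2 ^ (1 + j + 1) + 6) ≤ 658 * (2 ^ j * 2 ^ j) := by
    calc (1 + j) * (163 * 2 ^ (1 + j + 1) + 6) ≤ 2 ^ j * (658 * 2 ^ j) := by
          refine Nat.mul_le_mul hj1 ?_
          have : 2 ^ (1 + j + 1) = 4 * 2 ^ j := by ring
          omega
      _ = 658 * (2 ^ j * 2 ^ j) := by ring
  omega

theorem logb_le_two_mul {n q : ℕ} (hn : 2 ≤ n) (hq : q = 1 + Nat.log 2 n / 2) :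
    Real.logb 2 n ≤ 2 * q := by
  have h1 : n ≤ 2 ^ (2 * q) := (Nat.lt_pow_succ_log_self (by norm_num) n).le.trans
    (Nat.pow_le_pow_right (by norm_num) (by omega))
  rw [Real.logb_le_iff_le_rpow (by norm_num) (by positivity)]
  have h2 : (n : ℝ) ≤ 2 ^ (2 * q) := by exact_mod_cast h1
  refine h2.trans_eq ?_
  rw [← Real.rpow_natCast]
  push_cast
  rfl

end

end QCircuit

theorem mainTheorem1 :
    ∃ K : ℝ, ∀ (n s : ℕ), 2 ≤ n →
      ∀ (S : Finset (QCircuit.Bits (Fin n))) (c : QCircuit.Bits (Fin n) → ℂ),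
        S.card = s → ∑ x ∈ S, ‖c x‖ ^ 2 = 1 →
          ∃ C : QCircuit.Circuit (Fin n ⊕ Fin 2),
            C.Prepares (QCircuit.sparseState S c) ∧
            (C.size : ℝ) ≤ K * ((n : ℝ) * (s : ℝ) / Real.logb 2 (n : ℝ) + (n : ℝ)) := by
  -- The constant is `2 * 1312`: `1312 * n` bounds one batch, and the 2 comes from `logb 2 n ≤ 2 *
  -- q`.
  refine ⟨2624, fun n s hn S c hs hc => ?_⟩
  obtain ⟨q, hq⟩ : ∃ q, q = 1 + Nat.log 2 n / 2 := ⟨_, rfl⟩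
  have hq0 : 0 < q := by omega
  have hr : S.card ≤ (s / q + 1) * q + 1 := by
    rw [hs]
    have := Nat.lt_div_mul_add (a := s) hq0
    rw [Nat.succ_mul]
    omega
  obtain ⟨C, hC, hsize⟩ :=
    (QCircuit.exists_reach_sparseState (by omega) S c hc hr).prepares
  refine ⟨C, hC, ?_⟩
  have hsize' : C.size ≤ (s / q + 1) * (1312 * n) + 4 * n := by
    refine hsize.trans (Nat.add_le_add (Nat.mul_le_mul le_rfl ?_) (by omega))
    exact QCircuit.batch_cost_le hn hq
  have hlog : 0 < Real.logb 2 n := Real.logb_pos (by norm_num) (by exact_mod_cast hn)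
  have hq0' : (0 : ℝ) < q := by exact_mod_cast hq0
  have hdiv : ((s / q : ℕ) : ℝ) ≤ 2 * (s / Real.logb 2 n) := by
    refine Nat.cast_div_le.trans ?_
    rw [mul_div_assoc', div_le_div_iff₀ hq0' hlog]
    have := mul_le_mul_of_nonneg_left (QCircuit.logb_le_two_mul hn hq) (Nat.cast_nonneg (α := ℝ) s)
    linarith
  calc (C.size : ℝ) ≤ ((s / q : ℕ) + 1) * (1312 * n) + 4 * n := by exact_mod_cast hsize'
    _ ≤ (2 * (s / Real.logb 2 n) + 1) * (1312 * n) + 4 * n := by gcongr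
    _ = 2624 * (n * s / Real.logb 2 n) + 1316 * n := by ring
    _ ≤ 2624 * (n * s / Real.logb 2 n + n) := by
      rw [mul_add]
      gcongr
      norm_num
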